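/- Let $1\le p<\infty$. Let $L_p\cap L_\infty$ be the Banach space of (classes of almost everywhere equal) real-valued, bounded (i.e. essentially bounded) and $p$-integrable measurable functions on $(0,\infty)$ with Lebesgue measure, equipped with the norm $\|x\|_{L_p\cap L_\infty}=\max\{\|x\|_{L_p},\|x\|_{L_\infty}\}$. Then $L_p\cap L_\infty$ contains a complemented subspace (the range of a bounded linear projection) isomorphic, i.e. linearly homeomorphic, to the real sequence space $l_2$ if and only if $p=2$. -/

import Mathlib

open MeasureTheory
open scoped ENNReal

noncomputable section

namespace LpCapLinfty

/-- Lebesgue measure on the half-line `(0, ∞)`. -/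
abbrev halfLine : Measure ℝ := volume.restrict (Set.Ioi (0 : ℝ))

/-- The linear space `L_p ∩ L_∞` inside the space of (classes modulo almost everywhere equality of)
real measurable functions on `(0, ∞)`. -/
def sub (p : ℝ≥0∞) : Submodule ℝ (ℝ →ₘ[halfLine] ℝ) :=
  Lp.LpSubmodule ℝ ℝ p halfLine ⊓ Lp.LpSubmodule ℝ ℝ ∞ halfLine

theorem mem_sub {p : ℝ≥0∞} {f : ℝ →ₘ[halfLine] ℝ} :
    f ∈ sub p ↔ eLpNorm f p halfLine < ∞ ∧ eLpNorm f ∞ halfLine < ∞ :=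
  Iff.rfl

/-- The space `L_p ∩ L_∞` on `(0, ∞)` as a type; its norm, given below, is the maximum of the
two norms. -/
def Space (p : ℝ≥0∞) : Type := sub p

instance (p : ℝ≥0∞) : AddCommGroup (Space p) := inferInstanceAs (AddCommGroup (sub p))

instance (p : ℝ≥0∞) : Module ℝ (Space p) := inferInstanceAs (Module ℝ (sub p))

/-- The inclusion of `L_p ∩ L_∞` into `L_p`. -/
def toLp (p : ℝ≥0∞) : Space p →ₗ[ℝ] Lp ℝ p halfLine where
  toFun f := ⟨f.1, f.2.1⟩
  map_add' _ _ := rfl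
  map_smul' _ _ := rfl

/-- The inclusion of `L_p ∩ L_∞` into `L_∞`. -/
def toLinfty (p : ℝ≥0∞) : Space p →ₗ[ℝ] Lp ℝ ∞ halfLine where
  toFun f := ⟨f.1, f.2.2⟩
  map_add' _ _ := rfl
  map_smul' _ _ := rfl

/-- The norm `max {‖x‖_{L_p}, ‖x‖_{L_∞}}`. -/
instance (p : ℝ≥0∞) : Norm (Space p) where
  norm f := max (eLpNorm f.1 p halfLine).toReal (eLpNorm f.1 ∞ halfLine).toReal

theorem norm_eq_max {p : ℝ≥0∞} (f : Space p) : ‖f‖ = max ‖toLp p f‖ ‖toLinfty p f‖ := rfl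

variable {p : ℝ≥0∞} [Fact (1 ≤ p)]

theorem normedSpaceCore : NormedSpace.Core ℝ (Space p) where
  norm_nonneg f := by
    rw [norm_eq_max]; positivity
  norm_smul c f := by
    rw [norm_eq_max, norm_eq_max, map_smul, map_smul, norm_smul, norm_smul,
      mul_max_of_nonneg _ _ (norm_nonneg c)]
  norm_triangle f g := by
    rw [norm_eq_max, norm_eq_max, norm_eq_max, map_add, map_add]
    exact max_le
      ((norm_add_le _ _).trans (add_le_add (le_max_left _ _) (le_max_left _ _)))
      ((norm_add_le _ _).trans (add_le_add (le_max_right _ _) (le_max_right _ _)))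
  norm_eq_zero_iff f := by
    constructor
    · intro h
      have h1 : ‖toLinfty p f‖ ≤ 0 := by
        rw [← h, norm_eq_max]; exact le_max_right _ _
      have h2 : toLinfty p f = 0 := norm_le_zero_iff.1 h1
      have h3 : f.1 = (0 : ℝ →ₘ[halfLine] ℝ) := congrArg Subtype.val h2
      exact Subtype.ext h3
    · rintro rfl
      rw [norm_eq_max, map_zero, map_zero, norm_zero, norm_zero, max_self]

instance : NormedAddCommGroup (Space p) := NormedAddCommGroup.ofCore normedSpaceCore

instance : NormedSpace ℝ (Space p) := NormedSpace.ofCore normedSpaceCore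

end LpCapLinfty

/-- The normed space `X` contains a complemented subspace isomorphic to `Y`: some linear subspace
of `X` is the range of a bounded linear projection of `X` and is linearly homeomorphic to `Y`. -/
def ContainsComplementedCopy (X Y : Type*) [NormedAddCommGroup X] [NormedSpace ℝ X]
    [NormedAddCommGroup Y] [NormedSpace ℝ Y] : Prop :=
  ∃ S : Submodule ℝ X, S.ClosedComplemented ∧ Nonempty (S ≃L[ℝ] Y)

end

/-!
A complemented copy of `l_2` in `X = L_p ∩ L_∞` is a factorization `T ∘ J = id` of the identity of
`l_2` through `X`. For `p = 2` such a factorization comes from step functions with steps of length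
one: `J` is the embedding of `l_2` by step functions, `T` the adjoint of the resulting isometry
into `L_2`.

For the converse let `f n` represent `J (e n)`. Since `J` is bounded into `L_∞`, representatives
can be chosen whose square function `(∑ f n ^ 2) ^ (1 / 2)` is bounded everywhere
(`exists_square_function_le`). On a set `E` of finite measure `X` is `L_∞ (E)`, and the little
Grothendieck inequality (`grothendieck`) bounds `∑ ‖T g_n‖ ^ 2` whenever the `g_n` live on `E` and
have bounded square function. Hence `T` does not see the part of the `f n` on a fixed set of finite
measure, asymptotically. A gliding hump then gives indices `n k` and disjoint intervals `D k` such
that the pieces `v k = 1_{D k} f (n k)` satisfy `∑_{k ∈ s} ‖T (v k)‖ ^ 2 ≥ (|s| - K) / 8` for all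
finite sets `s` (`exists_disjoint_pieces`). The tails of the `f n` tend to zero in `L_p` but perhaps
not in `L_∞`; the places where they are large form a set of finite measure, so the little Grothendieck
inequality disposes of them too.

The signed sums `∑ ± v k` have norm at most `max (sup ‖v k‖_∞) ((∑ ‖v k‖_p ^ p) ^ (1 / p))`, and the
mean square of their images under `T` is `∑ ‖T (v k)‖ ^ 2`. As the `v k` are bounded, this gives
`|s| ≲ |s| ^ (2 / p)`, so `p ≤ 2`. On the other hand the signed sums of the `f (n k)` have norm
at most a multiple of `|s| ^ (1 / 2)`, whence `∑_{k ∈ s} ‖v k‖_p ^ p ≲ |s| ^ (p / 2)`. If `p < 2` this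
forces `‖v k‖_p → 0`, and suitable `N` of the `v k` have signed sums bounded independently of `N`,
which is impossible.

The little Grothendieck inequality is proved by truncating Rademacher sums: the truncation is
bounded, and the Rademacher coefficients of the remainder have a square function at most half the
original one (`grothendieck_step`), so the constant improves itself.
-/

noncomputable section

/-! ### Rademacher averages -/

namespace Rademacher

variable {ι : Type*}

/-- The `i`-th Rademacher function on the cube `ι → Bool`, with values `1` and `-1`. -/
def rad (i : ι) (ω : ι → Bool) : ℝ := if ω i then 1 else -1

theorem rad_sq (i : ι) (ω : ι → Bool) : rad i ω ^ 2 = 1 := by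
  unfold rad; split_ifs <;> norm_num

theorem abs_rad (i : ι) (ω : ι → Bool) : |rad i ω| = 1 := by
  unfold rad; split_ifs <;> norm_num

variable [DecidableEq ι]

theorem rad_update_of_ne {i j : ι} (h : j ≠ i) (ω : ι → Bool) (b : Bool) :
    rad j (Function.update ω i b) = rad j ω := by
  simp [rad, Function.update_of_ne h]

variable [Fintype ι]

/-- The average of a function over the cube. -/
def avg {E : Type*} [AddCommGroup E] [Module ℝ E] (g : (ι → Bool) → E) : E :=
  ((2 : ℝ) ^ Fintype.card ι)⁻¹ • ∑ ω, g ω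

section
variable {E : Type*} [AddCommGroup E] [Module ℝ E]

theorem avg_add (g h : (ι → Bool) → E) : avg (fun ω => g ω + h ω) = avg g + avg h := by
  simp [avg, Finset.sum_add_distrib]

theorem avg_sum {κ : Type*} (s : Finset κ) (g : κ → (ι → Bool) → E) :
    avg (fun ω => ∑ k ∈ s, g k ω) = ∑ k ∈ s, avg (g k) := by
  simp only [avg, Finset.smul_sum]
  exact Finset.sum_comm

theorem avg_map {F : Type*} [AddCommGroup F] [Module ℝ F] (L : E →ₗ[ℝ] F) (g : (ι → Bool) → E) :
    L (avg g) = avg (fun ω => L (g ω)) := by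
  simp [avg]

theorem avg_const (x : E) : avg (fun _ : ι → Bool => x) = x := by
  simp only [avg, Finset.sum_const, Finset.card_univ, Fintype.card_fun, Fintype.card_bool]
  rw [← Nat.cast_smul_eq_nsmul ℝ, smul_smul]
  simp

end

theorem avg_mul_left (c : ℝ) (g : (ι → Bool) → ℝ) : avg (fun ω => c * g ω) = c * avg g := by
  simp only [avg, smul_eq_mul, ← Finset.mul_sum]; ring

theorem avg_mono {g h : (ι → Bool) → ℝ} (H : ∀ ω, g ω ≤ h ω) : avg g ≤ avg h := by
  simp only [avg, smul_eq_mul]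
  gcongr with ω
  exact H ω

theorem avg_le_const {g : (ι → Bool) → ℝ} {c : ℝ} (H : ∀ ω, g ω ≤ c) : avg g ≤ c :=
  (avg_mono H).trans_eq (avg_const c)

/-- A Rademacher function averages to zero against anything that does not depend on its
coordinate. -/
theorem avg_rad_mul (i : ι) (g : (ι → Bool) → ℝ)
    (hg : ∀ ω b, g (Function.update ω i b) = g ω) : avg (fun ω => rad i ω * g ω) = 0 := by
  have : ∑ ω, rad i ω * g ω = 0 := by
    refine Finset.sum_involution (fun ω _ => Function.update ω i (!ω i)) ?_ ?_ ?_ ?_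
    · intro ω _
      rw [hg]
      simp only [rad, Function.update_self]
      cases ω i <;> simp
    · intro ω _ _ h
      have := congrFun h i
      simp at this
    · simp
    · intro ω _
      simp
  simp [avg, this]

theorem avg_rad_mul_rad (i j : ι) :
    avg (fun ω : ι → Bool => rad i ω * rad j ω) = if i = j then 1 else 0 := by
  split_ifs with h
  · subst h
    simp only [← sq, rad_sq]
    exact avg_const 1
  · exact avg_rad_mul i _ fun ω b => rad_update_of_ne (Ne.symm h) ω b

/-- Orthogonality of the Rademacher functions, with coefficients in an inner product space. -/
theorem avg_norm_sq {H : Type*} [NormedAddCommGroup H] [InnerProductSpace ℝ H] (h : ι → H) :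
    avg (fun ω => ‖∑ i, rad i ω • h i‖ ^ 2) = ∑ i, ‖h i‖ ^ 2 := by
  have : ∀ ω, ‖∑ i, rad i ω • h i‖ ^ 2
      = ∑ i, ∑ j, inner ℝ (h i) (h j) * (rad i ω * rad j ω) := by
    intro ω
    rw [← real_inner_self_eq_norm_sq, sum_inner]
    refine Finset.sum_congr rfl fun i _ => ?_
    rw [inner_sum]
    refine Finset.sum_congr rfl fun j _ => ?_
    rw [real_inner_smul_left, real_inner_smul_right]; ring
  simp only [this, avg_sum, avg_mul_left, avg_rad_mul_rad]
  simp

/-- Bessel's inequality for the Rademacher system. -/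
theorem bessel (R : (ι → Bool) → ℝ) :
    ∑ i, avg (fun ω => rad i ω * R ω) ^ 2 ≤ avg (fun ω => R ω ^ 2) := by
  set c : ι → ℝ := fun i => avg (fun ω => rad i ω * R ω) with hc
  have h0 : 0 ≤ avg (fun ω => (R ω - ∑ i, rad i ω * c i) ^ 2) := by
    rw [← avg_const (ι := ι) (0 : ℝ)]
    exact avg_mono fun ω => sq_nonneg _
  have h1 : ∀ ω, (R ω - ∑ i, rad i ω * c i) ^ 2
      = R ω ^ 2 + ((∑ i, (-2 * c i) * (rad i ω * R ω)) + ‖∑ i, rad i ω • c i‖ ^ 2) := by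
    intro ω
    rw [Real.norm_eq_abs, sq_abs]
    have : ∑ i, (-2 * c i) * (rad i ω * R ω) = -2 * R ω * ∑ i, rad i ω * c i := by
      rw [Finset.mul_sum]
      exact Finset.sum_congr rfl fun i _ => by ring
    rw [this]
    simp only [smul_eq_mul]
    ring
  simp only [h1] at h0
  rw [avg_add, avg_add, avg_sum, avg_norm_sq] at h0
  simp only [avg_mul_left, Real.norm_eq_abs, sq_abs] at h0
  change 0 ≤ _ + (∑ i, -2 * c i * c i + _) at h0
  have h2 : ∑ i, -2 * c i * c i = -2 * ∑ i, c i ^ 2 := by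
    rw [Finset.mul_sum]
    exact Finset.sum_congr rfl fun i _ => by ring
  rw [h2] at h0
  linarith

theorem avg_sum_sq (a : ι → ℝ) (s : Finset ι) :
    avg (fun ω => (∑ i ∈ s, rad i ω * a i) ^ 2) = ∑ i ∈ s, a i ^ 2 := by
  have := avg_norm_sq (fun i => if i ∈ s then a i else 0)
  simpa [Finset.sum_ite_mem, ite_pow] using this

/-- The fourth moment inequality for Rademacher sums. -/
theorem avg_sum_pow_four_le (a : ι → ℝ) (s : Finset ι) :
    avg (fun ω => (∑ i ∈ s, rad i ω * a i) ^ 4) ≤ 3 * (∑ i ∈ s, a i ^ 2) ^ 2 := by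
  induction s using Finset.induction_on with
  | empty => simp [avg]
  | insert i s hi ih =>
    have hS : ∀ (ω : ι → Bool) b,
        ∑ j ∈ s, rad j (Function.update ω i b) * a j = ∑ j ∈ s, rad j ω * a j := fun ω b =>
      Finset.sum_congr rfl fun j hj => by
        rw [rad_update_of_ne (ne_of_mem_of_not_mem hj hi)]
    have h1 : ∀ ω, (∑ j ∈ insert i s, rad j ω * a j) ^ 4
        = a i ^ 4 + (4 * a i ^ 3 * (rad i ω * ∑ j ∈ s, rad j ω * a j)
          + (6 * a i ^ 2 * (∑ j ∈ s, rad j ω * a j) ^ 2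
            + (4 * a i * (rad i ω * (∑ j ∈ s, rad j ω * a j) ^ 3)
              + (∑ j ∈ s, rad j ω * a j) ^ 4))) := by
      intro ω
      rw [Finset.sum_insert hi]
      have h2 := rad_sq i ω
      generalize ∑ j ∈ s, rad j ω * a j = S
      generalize rad i ω = r at h2
      linear_combination (a i ^ 4 * (r ^ 2 + 1) + 4 * a i ^ 3 * S * r + 6 * a i ^ 2 * S ^ 2) * h2
    simp only [h1]
    rw [avg_add, avg_add, avg_add, avg_add, avg_mul_left, avg_mul_left, avg_mul_left, avg_const,
      avg_rad_mul i _ hS, avg_sum_sq, avg_rad_mul i _ fun ω b => by rw [hS],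
      Finset.sum_insert hi]
    nlinarith [sq_nonneg (a i ^ 2)]

/-- Jensen's inequality: a Rademacher sum has at least the `q`-th moment of each of its terms. -/
theorem rpow_abs_le_avg (a : ι → ℝ) (i : ι) {q : ℝ} (hq : 1 ≤ q) :
    |a i| ^ q ≤ avg (fun ω => |∑ j, rad j ω * a j| ^ q) := by
  have h1 : a i = avg (fun ω => rad i ω * ∑ j, rad j ω * a j) := by
    simp only [Finset.mul_sum, avg_sum, ← mul_assoc]
    simp only [mul_comm _ (a _), avg_mul_left, avg_rad_mul_rad]
    simp
  have h2 : |a i| ≤ ∑ ω : ι → Bool,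
      ((2 : ℝ) ^ Fintype.card ι)⁻¹ * |∑ j, rad j ω * a j| := by
    conv_lhs => rw [h1]
    simp only [avg, smul_eq_mul, Finset.mul_sum (s := (Finset.univ : Finset (ι → Bool)))]
    refine (Finset.abs_sum_le_sum_abs _ _).trans (Finset.sum_le_sum fun ω _ => ?_)
    rw [abs_mul, abs_mul, abs_rad, one_mul, abs_of_pos (by positivity)]
  refine (Real.rpow_le_rpow (abs_nonneg _) h2 (by linarith)).trans ?_
  refine (Real.rpow_arith_mean_le_arith_mean_rpow Finset.univ _ _ (fun _ _ => by positivity) ?_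
    (fun _ _ => abs_nonneg _) hq).trans_eq ?_
  · simp
  · simp [avg, Finset.mul_sum]

end Rademacher

/-! ### The little Grothendieck inequality -/

/-- Truncation of a real number at level `c ≥ 0`. -/
def clamp (c x : ℝ) : ℝ := max (-c) (min x c)

theorem abs_clamp_le {c : ℝ} (hc : 0 ≤ c) (x : ℝ) : |clamp c x| ≤ c :=
  abs_le.2 ⟨le_max_left _ _, max_le (by linarith) (min_le_right _ _)⟩

theorem abs_clamp_le_abs {c : ℝ} (hc : 0 ≤ c) (x : ℝ) : |clamp c x| ≤ |x| := by
  unfold clamp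
  grind

theorem sub_clamp_sq_le {c : ℝ} (hc : 0 ≤ c) (x : ℝ) : c ^ 2 * (x - clamp c x) ^ 2 ≤ x ^ 4 := by
  have h : c * |x - clamp c x| ≤ x ^ 2 := by
    unfold clamp
    rcases le_total x c with h1 | h1
    · rw [min_eq_left h1]
      rcases le_total (-c) x with h2 | h2
      · rw [max_eq_right h2]; simp; positivity
      · rw [max_eq_left h2, abs_of_nonpos (by linarith)]; nlinarith
    · rw [min_eq_right h1, max_eq_right (by linarith), abs_of_nonneg (by linarith)]; nlinarith
  calc c ^ 2 * (x - clamp c x) ^ 2 = (c * |x - clamp c x|) ^ 2 := by rw [mul_pow, sq_abs]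
    _ ≤ (x ^ 2) ^ 2 := by gcongr
    _ = x ^ 4 := by ring

section Grothendieck

open Rademacher

variable {α H : Type*} [NormedAddCommGroup H] [InnerProductSpace ℝ H]
  {V : Submodule ℝ (α → ℝ)} (L : V →ₗ[ℝ] H) {C : ℝ}

/-- The self-improvement behind the little Grothendieck inequality. A Rademacher sum of the `f i` is
split at height `4 * s` into its truncation, which `L` controls directly, and a remainder whose
Rademacher coefficients again have a square function, at most `s / 2` by the fourth moment
inequality. -/
theorem grothendieck_step (hC : 0 ≤ C) (hV : ∀ f ∈ V, ∀ c, 0 ≤ c → (fun t => clamp c (f t)) ∈ V)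
    (hL : ∀ (f : V) (c : ℝ), 0 ≤ c → (∀ t, |f.1 t| ≤ c) → ‖L f‖ ≤ C * c)
    {ι : Type*} [Fintype ι] (h : ι → H) {K : ℝ}
    (hK : ∀ (f : ι → V) (s : ℝ), 0 < s → (∀ t, ∑ i, (f i).1 t ^ 2 ≤ s ^ 2) →
      ∑ i, inner ℝ (L (f i)) (h i) ≤ K * s * √(∑ i, ‖h i‖ ^ 2))
    (f : ι → V) (s : ℝ) (hs : 0 < s) (hf : ∀ t, ∑ i, (f i).1 t ^ 2 ≤ s ^ 2) :
    ∑ i, inner ℝ (L (f i)) (h i) ≤ (4 * C + K / 2) * s * √(∑ i, ‖h i‖ ^ 2) := by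
  classical
  set Q := √(∑ i, ‖h i‖ ^ 2) with hQ
  have hQ2 : Q ^ 2 = ∑ i, ‖h i‖ ^ 2 := Real.sq_sqrt (by positivity)
  let F : (ι → Bool) → V := fun ω => ∑ i, rad i ω • f i
  let G : (ι → Bool) → V := fun ω => ⟨_, hV (F ω).1 (F ω).2 (4 * s) (by positivity)⟩
  let r : ι → V := fun i => avg fun ω => rad i ω • (F ω - G ω)
  have hFt : ∀ ω t, (F ω).1 t = ∑ i, rad i ω * (f i).1 t := by
    intro ω t
    simp [F, Finset.sum_apply]
  have hrt : ∀ i t, (r i).1 t = avg fun ω => rad i ω * ((F ω).1 t - (G ω).1 t) := fun i t =>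
    avg_map ((LinearMap.proj t).comp V.subtype) _
  have hr : ∀ t, ∑ i, (r i).1 t ^ 2 ≤ (s / 2) ^ 2 := by
    intro t
    simp only [hrt]
    refine (bessel _).trans ?_
    have h1 : (4 * s) ^ 2 * avg (fun ω => ((F ω).1 t - (G ω).1 t) ^ 2)
        ≤ 3 * (∑ i, (f i).1 t ^ 2) ^ 2 := by
      rw [← avg_mul_left]
      refine (avg_mono fun ω => sub_clamp_sq_le (by positivity) _).trans ?_
      simp only [hFt]
      exact avg_sum_pow_four_le _ _
    have h2 : (∑ i, (f i).1 t ^ 2) ^ 2 ≤ (s ^ 2) ^ 2 := by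
      have := hf t
      gcongr
    have hs2 : 0 < s ^ 2 := by positivity
    refine le_of_mul_le_mul_left (a := 16 * s ^ 2) ?_ (by positivity)
    nlinarith
  have hHω : avg (fun ω => ‖∑ i, rad i ω • h i‖) ≤ Q := by
    refine abs_le_of_sq_le_sq' ?_ (Real.sqrt_nonneg _) |>.2
    rw [hQ2, ← avg_norm_sq]
    -- Jensen's inequality, from the nonnegativity of the variance.
    set m := avg (fun ω => ‖∑ i, rad i ω • h i‖) with hm
    have h0 : 0 ≤ avg (fun ω => (‖∑ i, rad i ω • h i‖ - m) ^ 2) := by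
      rw [← avg_const (ι := ι) (0 : ℝ)]
      exact avg_mono fun ω => sq_nonneg _
    have h2 : ∀ ω, (‖∑ i, rad i ω • h i‖ - m) ^ 2
        = ‖∑ i, rad i ω • h i‖ ^ 2 + ((-2 * m) * ‖∑ i, rad i ω • h i‖ + m ^ 2) := fun ω => by ring
    simp only [h2] at h0
    rw [avg_add, avg_add, avg_mul_left, avg_const, ← hm] at h0
    linarith
  -- Both sums are averages against `∑ i, rad i ω • h i`.
  have hsplit : ∑ i, inner ℝ (L (f i)) (h i)
      = avg (fun ω => inner ℝ (L (G ω)) (∑ i, rad i ω • h i))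
        + ∑ i, inner ℝ (L (r i)) (h i) := by
    have h1 : ∑ i, inner ℝ (L (f i)) (h i)
        = avg (fun ω => inner ℝ (L (F ω)) (∑ i, rad i ω • h i)) := by
      have : ∀ ω, inner ℝ (L (F ω)) (∑ i, rad i ω • h i)
          = ∑ i, ∑ j, inner ℝ (L (f j)) (h i) * (rad i ω * rad j ω) := by
        intro ω
        simp only [F, map_sum, map_smul, sum_inner, inner_sum, real_inner_smul_left,
          real_inner_smul_right]
        refine Finset.sum_congr rfl fun i _ => Finset.sum_congr rfl fun j _ => by ring
      simp only [this, avg_sum, avg_mul_left, avg_rad_mul_rad]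
      simp
    have h2 : ∑ i, inner ℝ (L (r i)) (h i)
        = avg (fun ω => inner ℝ (L (F ω - G ω)) (∑ i, rad i ω • h i)) := by
      simp only [inner_sum, avg_sum]
      refine Finset.sum_congr rfl fun i _ => ?_
      rw [avg_map L, real_inner_comm]
      refine (avg_map (innerₗ H (h i)) _).trans ?_
      congr 1
      ext ω
      rw [map_smul, map_smul, real_inner_smul_right, innerₗ_apply_apply, real_inner_comm, smul_eq_mul]
    rw [h1, h2, ← avg_add]
    congr 1
    ext ω
    rw [← inner_add_left, ← map_add, add_sub_cancel]
  rw [hsplit]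
  have hG : avg (fun ω => inner ℝ (L (G ω)) (∑ i, rad i ω • h i)) ≤ C * (4 * s) * Q := by
    refine (avg_mono (h := fun ω => C * (4 * s) * ‖∑ i, rad i ω • h i‖) fun ω => ?_).trans ?_
    · refine (real_inner_le_norm _ _).trans ?_
      gcongr
      exact hL _ _ (by positivity) fun t => abs_clamp_le (by positivity) _
    · rw [avg_mul_left]
      gcongr
  have hR := hK r (s / 2) (by positivity) hr
  calc _ ≤ C * (4 * s) * Q + K * (s / 2) * Q := add_le_add hG hR
    _ = _ := by ring

/-- The little Grothendieck inequality: an operator into a Hilbert space that is bounded for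
the supremum norm is bounded on square functions, with an absolute constant. -/
theorem grothendieck (hC : 0 ≤ C) (hV : ∀ f ∈ V, ∀ c, 0 ≤ c → (fun t => clamp c (f t)) ∈ V)
    (hL : ∀ (f : V) (c : ℝ), 0 ≤ c → (∀ t, |f.1 t| ≤ c) → ‖L f‖ ≤ C * c)
    {ι : Type*} [Fintype ι] (f : ι → V) (s : ℝ) (hs : 0 < s)
    (hf : ∀ t, ∑ i, (f i).1 t ^ 2 ≤ s ^ 2) :
    ∑ i, ‖L (f i)‖ ^ 2 ≤ 64 * C ^ 2 * s ^ 2 := by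
  set h : ι → H := fun i => L (f i) with hh
  set Q := √(∑ i, ‖h i‖ ^ 2) with hQ
  have hQ2 : Q ^ 2 = ∑ i, ‖h i‖ ^ 2 := Real.sq_sqrt (by positivity)
  have key : ∀ n : ℕ, ∀ (f : ι → V) (s : ℝ), 0 < s → (∀ t, ∑ i, (f i).1 t ^ 2 ≤ s ^ 2) →
      ∑ i, inner ℝ (L (f i)) (h i)
        ≤ (8 * C + (Fintype.card ι * C) * (1 / 2) ^ n) * s * Q := by
    intro n
    induction n with
    | zero =>
      intro f s hs hf
      have h1 : ∀ i, inner ℝ (L (f i)) (h i) ≤ C * s * Q := by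
        intro i
        refine (real_inner_le_norm _ _).trans ?_
        gcongr
        · refine hL _ _ hs.le fun t => abs_le_of_sq_le_sq ?_ hs.le
          exact (Finset.single_le_sum (f := fun i => (f i).1 t ^ 2)
            (fun _ _ => sq_nonneg _) (Finset.mem_univ i)).trans (hf t)
        · refine Real.le_sqrt_of_sq_le ?_
          exact Finset.single_le_sum (f := fun i => ‖h i‖ ^ 2)
            (fun _ _ => sq_nonneg _) (Finset.mem_univ i)
      calc _ ≤ ∑ i : ι, C * s * Q := Finset.sum_le_sum fun i _ => h1 i
        _ = (Fintype.card ι * C) * s * Q := by simp; ring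
        _ ≤ _ := by
          have : 0 ≤ C * s * Q := by positivity
          nlinarith
    | succ n ih =>
      intro f s hs hf
      refine (grothendieck_step L hC hV hL h ih f s hs hf).trans_eq ?_
      rw [pow_succ]; ring
  have hlim : ∑ i, inner ℝ (L (f i)) (h i) ≤ 8 * C * s * Q := by
    have ht : Filter.Tendsto
        (fun n : ℕ => (8 * C + (Fintype.card ι * C) * (1 / 2 : ℝ) ^ n) * s * Q) Filter.atTop
        (nhds ((8 * C + (Fintype.card ι * C) * 0) * s * Q)) :=
      (((tendsto_pow_atTop_nhds_zero_of_lt_one (by norm_num) (by norm_num)).const_mul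
        _).const_add _ |>.mul_const _).mul_const _
    simpa using ge_of_tendsto' ht fun n => key n f s hs hf
  have h1 : Q ^ 2 ≤ 8 * C * s * Q := by
    rw [hQ2]
    simpa [hh, real_inner_self_eq_norm_sq] using hlim
  have hQ0 : 0 ≤ Q := Real.sqrt_nonneg _
  have h2 : Q ≤ 8 * C * s := by
    rcases hQ0.eq_or_lt with h0 | h0
    · rw [← h0]; positivity
    · nlinarith
  rw [← hQ2]
  calc Q ^ 2 ≤ (8 * C * s) ^ 2 := by gcongr
    _ = _ := by ring

end Grothendieck

/-! ### Functions representing elements of the space -/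

namespace LpCapLinfty

/-- The functions on the line whose class belongs to `L_p ∩ L_∞` of the half-line. -/
def Fun (p : ℝ≥0∞) : Submodule ℝ (ℝ → ℝ) where
  carrier := {f | MemLp f p halfLine ∧ MemLp f ∞ halfLine}
  add_mem' hf hg := ⟨hf.1.add hg.1, hf.2.add hg.2⟩
  zero_mem' := ⟨MemLp.zero, MemLp.zero⟩
  smul_mem' c _ hf := ⟨hf.1.const_smul c, hf.2.const_smul c⟩

/-- The class of a function modulo almost everywhere equality. -/
def cls (p : ℝ≥0∞) : Fun p →ₗ[ℝ] Space p where
  toFun f := (⟨AEEqFun.mk f.1 f.2.1.1, by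
    rw [mem_sub, eLpNorm_congr_ae (AEEqFun.coeFn_mk _ _), eLpNorm_congr_ae (AEEqFun.coeFn_mk _ _)]
    exact ⟨f.2.1.2, f.2.2.2⟩⟩ : sub p)
  map_add' _ _ := rfl
  map_smul' _ _ := rfl

variable {p : ℝ≥0∞}

theorem norm_cls (f : Fun p) :
    ‖cls p f‖ = max (eLpNorm f.1 p halfLine).toReal (eLpNorm f.1 ∞ halfLine).toReal := by
  change max (eLpNorm (AEEqFun.mk f.1 f.2.1.1) p halfLine).toReal
    (eLpNorm (AEEqFun.mk f.1 f.2.1.1) ∞ halfLine).toReal = _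
  rw [eLpNorm_congr_ae (AEEqFun.coeFn_mk _ _), eLpNorm_congr_ae (AEEqFun.coeFn_mk _ _)]

theorem norm_cls_le {f : Fun p} {c : ℝ} (hc : 0 ≤ c)
    (h1 : eLpNorm f.1 p halfLine ≤ ENNReal.ofReal c) (h2 : ∀ t, |f.1 t| ≤ c) : ‖cls p f‖ ≤ c := by
  rw [norm_cls]
  refine max_le (ENNReal.toReal_le_of_le_ofReal hc h1) (ENNReal.toReal_le_of_le_ofReal hc ?_)
  rw [eLpNorm_exponent_top]
  exact eLpNormEssSup_le_of_ae_bound (Filter.Eventually.of_forall h2)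

theorem ae_abs_le_norm_cls (f : Fun p) : ∀ᵐ t ∂halfLine, |f.1 t| ≤ ‖cls p f‖ := by
  have h := enorm_ae_le_eLpNormEssSup f.1 halfLine
  filter_upwards [h] with t ht
  rw [← eLpNorm_exponent_top] at ht
  rw [norm_cls]
  refine le_trans ?_ (le_max_right _ _)
  have := ENNReal.toReal_mono f.2.2.2.ne ht
  simpa using this

theorem eLpNorm_le_norm_cls (f : Fun p) :
    eLpNorm f.1 p halfLine ≤ ENNReal.ofReal ‖cls p f‖ := by
  rw [ENNReal.le_ofReal_iff_toReal_le f.2.1.2.ne (by rw [norm_cls]; positivity), norm_cls]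
  exact le_max_left _ _

theorem exists_measurable_cls_eq (x : Space p) : ∃ f : Fun p, Measurable f.1 ∧ cls p f = x := by
  have hx := mem_sub.1 x.2
  refine ⟨⟨x.1, ⟨x.1.aestronglyMeasurable, hx.1⟩, ⟨x.1.aestronglyMeasurable, hx.2⟩⟩,
    x.1.measurable, Subtype.ext ?_⟩
  exact AEEqFun.mk_coeFn _

theorem cls_eq_of_ae {f g : Fun p} (h : f.1 =ᵐ[halfLine] g.1) : cls p f = cls p g :=
  Subtype.ext (AEEqFun.mk_eq_mk.2 h)

/-- The restriction of a function to a measurable set, extended by zero. -/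
def res {E : Set ℝ} (hE : MeasurableSet E) : Fun p →ₗ[ℝ] Fun p where
  toFun f := ⟨E.indicator f.1, f.2.1.indicator hE, f.2.2.indicator hE⟩
  map_add' _ _ := Subtype.ext (Set.indicator_add _ _ _)
  map_smul' c f := Subtype.ext (Set.indicator_const_smul E c f.1)

theorem res_apply {E : Set ℝ} (hE : MeasurableSet E) (f : Fun p) (t : ℝ) :
    (res hE f).1 t = E.indicator f.1 t := rfl

theorem abs_res_le {E : Set ℝ} (hE : MeasurableSet E) (f : Fun p) (t : ℝ) :
    |(res hE f).1 t| ≤ |f.1 t| := by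
  rw [res_apply]
  exact norm_indicator_le_norm_self (E := ℝ) _ _

/-- A sequence in `L_p ∩ L_∞` that is dominated by the unit vectors of `l_2` has representatives
whose square function is bounded everywhere. -/
theorem exists_square_function_le (x : ℕ → Space p) {A : ℝ} (hA : 0 ≤ A)
    (hx : ∀ (N : ℕ) (a : Fin N → ℝ), ∀ y : Space p, y = ∑ i, a i • x i →
      ‖y‖ ≤ A * √(∑ i, a i ^ 2)) :
    ∃ f : ℕ → Fun p, (∀ n, Measurable (f n).1) ∧ (∀ n, cls p (f n) = x n) ∧
      ∀ N t, ∑ i : Fin N, (f i).1 t ^ 2 ≤ A ^ 2 := by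
  choose g hgm hgx using fun n => exists_measurable_cls_eq (x n)
  let G : Set ℝ := {t | ∀ N, ∑ i : Fin N, (g i).1 t ^ 2 ≤ A ^ 2}
  have hG : MeasurableSet G := by
    simp only [G, Set.ofPred_forall]
    refine MeasurableSet.iInter fun N => measurableSet_le ?_ measurable_const
    exact Finset.measurable_fun_sum _ fun i _ => (hgm i).pow_const 2
  have hae : ∀ᵐ t ∂halfLine, t ∈ G := by
    refine ae_all_iff.2 fun N => ?_
    have h1 : ∀ᵐ t ∂halfLine, ∀ a : Fin N → ℚ,
        |∑ i, (a i : ℝ) * (g i).1 t| ≤ A * √(∑ i, (a i : ℝ) ^ 2) := by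
      refine ae_all_iff.2 fun a => ?_
      filter_upwards [ae_abs_le_norm_cls (∑ i, (a i : ℝ) • g i)] with t ht
      have h2 := hx N (fun i => a i) (cls p (∑ i, (a i : ℝ) • g i)) (by simp [hgx])
      refine le_trans (le_of_eq ?_) (ht.trans h2)
      simp [Finset.sum_apply]
    filter_upwards [h1] with t ht
    have h2 : ∀ a : Fin N → ℝ, |∑ i, a i * (g i).1 t| ≤ A * √(∑ i, a i ^ 2) := by
      have hd : DenseRange (fun (a : Fin N → ℚ) (i : Fin N) => (a i : ℝ)) :=
        DenseRange.piMap fun _ => Rat.denseRange_cast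
      intro a
      induction a using hd.induction_on with
      | hp => exact isClosed_le (by fun_prop) (by fun_prop)
      | ih a => exact ht a
    have h3 := h2 fun i => (g i).1 t
    set S := ∑ i : Fin N, (g i).1 t ^ 2 with hS
    have hS0 : 0 ≤ S := by positivity
    have h4 : S ≤ A * √S := by
      refine le_trans (le_of_eq ?_) h3
      rw [abs_of_nonneg (Finset.sum_nonneg fun _ _ => mul_self_nonneg _), hS]
      exact Finset.sum_congr rfl fun _ _ => sq _
    have h5 := Real.sq_sqrt hS0
    have h6 := Real.sqrt_nonneg S
    have h7 : √S ≤ A := by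
      rcases h6.eq_or_lt with h0 | h0
      · rw [← h0]; exact hA
      · nlinarith
    rw [← h5]
    gcongr
  refine ⟨fun n => res hG (g n), fun n => (hgm n).indicator hG, fun n => ?_, fun N t => ?_⟩
  · rw [← hgx n]
    refine cls_eq_of_ae ?_
    filter_upwards [hae] with t ht
    rw [res_apply, Set.indicator_of_mem ht]
  · by_cases ht : t ∈ G
    · simpa only [res_apply, Set.indicator_of_mem ht] using ht N
    · simp only [res_apply, Set.indicator_of_notMem ht]
      simpa using sq_nonneg A

/-- A bound for the norm of the inclusion of `L_∞ (E)` into `L_p ∩ L_∞`, for a set `E` of finite measure. -/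
def incl (p : ℝ≥0∞) (E : Set ℝ) : ℝ := max 1 (halfLine E ^ (1 / p.toReal)).toReal

theorem incl_nonneg (p : ℝ≥0∞) (E : Set ℝ) : 0 ≤ incl p E := by unfold incl; positivity

theorem norm_cls_le_incl (hp0 : p ≠ 0) (hp : p ≠ ∞) {E : Set ℝ} (hE : MeasurableSet E)
    (hE' : halfLine E ≠ ∞) {f : Fun p} {c : ℝ} (hc : 0 ≤ c) (hf : ∀ t, |f.1 t| ≤ c)
    (hfE : ∀ t ∉ E, f.1 t = 0) : ‖cls p f‖ ≤ incl p E * c := by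
  refine norm_cls_le (mul_nonneg (incl_nonneg _ _) hc) ?_ fun t => (hf t).trans ?_
  · have h1 : eLpNorm f.1 p halfLine ≤ eLpNorm (E.indicator fun _ => c) p halfLine := by
      refine eLpNorm_mono fun t => ?_
      by_cases ht : t ∈ E
      · rw [Set.indicator_of_mem ht, Real.norm_eq_abs, Real.norm_eq_abs]
        exact (hf t).trans (le_abs_self c)
      · simp [hfE t ht]
    refine h1.trans ?_
    rw [eLpNorm_indicator_const hE hp0 hp, mul_comm, ENNReal.ofReal_mul (incl_nonneg _ _),
      Real.enorm_of_nonneg hc]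
    gcongr
    rw [ENNReal.le_ofReal_iff_toReal_le (by finiteness) (incl_nonneg _ _)]
    exact le_max_right _ _
  · exact le_mul_of_one_le_left hc (le_max_left _ _)

variable [Fact (1 ≤ p)]

/-- On a set of finite measure an operator from `L_p ∩ L_∞` into a Hilbert space obeys the little
Grothendieck inequality. -/
theorem sum_norm_sq_le_of_support {H : Type*} [NormedAddCommGroup H] [InnerProductSpace ℝ H]
    (hp : p ≠ ∞) (T : Space p →L[ℝ] H) {E : Set ℝ} (hE : MeasurableSet E)
    (hE' : halfLine E ≠ ∞) {ι : Type*} [Fintype ι] (f : ι → Fun p) (hfE : ∀ i, ∀ t ∉ E, (f i).1 t = 0)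
    {s : ℝ} (hs : 0 < s) (hf : ∀ t, ∑ i, (f i).1 t ^ 2 ≤ s ^ 2) :
    ∑ i, ‖T (cls p (f i))‖ ^ 2 ≤ 64 * (‖T‖ * incl p E) ^ 2 * s ^ 2 := by
  have hp0 : p ≠ 0 := (zero_lt_one.trans_le (Fact.out : 1 ≤ p)).ne'
  let V : Submodule ℝ (ℝ → ℝ) :=
    { carrier := {f | f ∈ Fun p ∧ ∀ t ∉ E, f t = 0}
      add_mem' := fun hf hg => ⟨add_mem hf.1 hg.1, fun t ht => by simp [hf.2 t ht, hg.2 t ht]⟩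
      zero_mem' := ⟨zero_mem _, fun _ _ => rfl⟩
      smul_mem' := fun c f hf => ⟨(Fun p).smul_mem c hf.1, fun t ht => by simp [hf.2 t ht]⟩ }
  have hVF : V ≤ Fun p := fun f hf => hf.1
  let L : V →ₗ[ℝ] H := T.toLinearMap ∘ₗ cls p ∘ₗ Submodule.inclusion hVF
  refine grothendieck L (C := ‖T‖ * incl p E) (by have := incl_nonneg p E; positivity) ?_ ?_
    (fun i => (⟨(f i).1, (f i).2, hfE i⟩ : V)) s hs hf
  · rintro f ⟨⟨h1, h2⟩, h3⟩ c hc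
    have hm : AEStronglyMeasurable (fun t => clamp c (f t)) halfLine := by
      have : Continuous (clamp c) := by unfold clamp; fun_prop
      exact this.comp_aestronglyMeasurable h1.1
    refine ⟨⟨h1.mono hm ?_, h2.mono hm ?_⟩, fun t ht => ?_⟩
    · exact Filter.Eventually.of_forall fun t => abs_clamp_le_abs hc _
    · exact Filter.Eventually.of_forall fun t => abs_clamp_le_abs hc _
    · simpa [h3 t ht] using abs_clamp_le_abs hc (0 : ℝ)
  · intro f c hc hfc
    refine (T.le_opNorm _).trans ?_
    rw [mul_assoc]
    gcongr
    exact norm_cls_le_incl hp0 hp hE hE' hc hfc f.2.2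

end LpCapLinfty

/-! ### The gliding hump -/

namespace LpCapLinfty

variable {p : ℝ≥0∞}

theorem tendsto_measure_Ioi_natCast (ν : Measure ℝ) [IsFiniteMeasure ν] :
    Filter.Tendsto (fun m : ℕ => ν (Set.Ioi (m : ℝ))) Filter.atTop (nhds 0) := by
  have h := tendsto_measure_iInter_atTop (μ := ν) (s := fun m : ℕ => Set.Ioi (m : ℝ))
    (fun _ => measurableSet_Ioi.nullMeasurableSet)
    (fun _ _ h => Set.Ioi_subset_Ioi (Nat.cast_le.2 h)) ⟨0, measure_ne_top _ _⟩
  have h0 : ⋂ m : ℕ, Set.Ioi (m : ℝ) = ∅ := by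
    refine Set.eq_empty_of_forall_notMem fun t ht => ?_
    obtain ⟨m, hm⟩ := exists_nat_ge t
    exact absurd (Set.mem_iInter.1 ht m) (not_lt.2 hm)
  rwa [h0, measure_empty] at h

theorem eLpNorm_le_iff (hp0 : p ≠ 0) (hp : p ≠ ∞) {μ : Measure ℝ} {f : ℝ → ℝ} {c : ℝ≥0∞} :
    eLpNorm f p μ ≤ c ↔ ∫⁻ t, ‖f t‖ₑ ^ p.toReal ∂μ ≤ c ^ p.toReal := by
  rw [eLpNorm_eq_lintegral_rpow_enorm_toReal hp0 hp, one_div,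
    ENNReal.rpow_inv_le_iff (ENNReal.toReal_pos hp0 hp)]

/-- Far out on the half-line, a function in `L_p` is small in norm, and the set where it is not
pointwise small has small measure. -/
theorem exists_tail_small (hp0 : p ≠ 0) (hp : p ≠ ∞) (f : Fun p) (hfm : Measurable f.1) {δ : ℝ}
    (hδ : 0 < δ) {η : ℝ≥0∞} (hη : 0 < η) (m : ℕ) :
    ∃ m' : ℕ, m ≤ m' ∧ eLpNorm ((Set.Ioi (m' : ℝ)).indicator f.1) p halfLine ≤ ENNReal.ofReal δ ∧
      halfLine ({t | δ < |f.1 t|} ∩ Set.Ioi (m' : ℝ)) ≤ η := by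
  have hq : 0 < p.toReal := ENNReal.toReal_pos hp0 hp
  have hfin : ∫⁻ t, ‖f.1 t‖ₑ ^ p.toReal ∂halfLine < ∞ :=
    (eLpNorm_lt_top_iff_lintegral_rpow_enorm_lt_top hp0 hp).1 f.2.1.2
  have hS : MeasurableSet {t | δ < |f.1 t|} := measurableSet_lt measurable_const hfm.abs
  have h1 : IsFiniteMeasure (halfLine.withDensity fun t => ‖f.1 t‖ₑ ^ p.toReal) :=
    isFiniteMeasure_withDensity hfin.ne
  have h2 : IsFiniteMeasure (halfLine.restrict {t | δ < |f.1 t|}) := by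
    refine ⟨?_⟩
    rw [Measure.restrict_apply_univ]
    have h3 := mul_meas_ge_le_lintegral₀ (μ := halfLine) (f := fun t => ‖f.1 t‖ₑ ^ p.toReal)
      (hfm.enorm.pow_const _).aemeasurable (ENNReal.ofReal δ ^ p.toReal)
    refine (measure_mono fun t ht => ?_).trans_lt
      ((ENNReal.le_div_iff_mul_le (Or.inl ?_) (Or.inl (by finiteness))).2
        ((mul_comm _ _).trans_le h3) |>.trans_lt ?_)
    · change ENNReal.ofReal δ ^ p.toReal ≤ ‖f.1 t‖ₑ ^ p.toReal
      have ht' : δ < |f.1 t| := ht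
      rw [Real.enorm_eq_ofReal_abs]
      gcongr
    · exact (ENNReal.rpow_pos (ENNReal.ofReal_pos.2 hδ) (by finiteness)).ne'
    · exact ENNReal.div_lt_top hfin.ne
        (ENNReal.rpow_pos (ENNReal.ofReal_pos.2 hδ) (by finiteness)).ne'
  have e1 := (tendsto_measure_Ioi_natCast
    (halfLine.withDensity fun t => ‖f.1 t‖ₑ ^ p.toReal)).eventually_le_const
      (u := ENNReal.ofReal δ ^ p.toReal)
      (ENNReal.rpow_pos (ENNReal.ofReal_pos.2 hδ) (by finiteness))
  have e2 := (tendsto_measure_Ioi_natCast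
    (halfLine.restrict {t | δ < |f.1 t|})).eventually_le_const hη
  obtain ⟨m', h1, h2, h3⟩ := (e1.and (e2.and (Filter.eventually_ge_atTop m))).exists
  refine ⟨m', h3, ?_, ?_⟩
  · rw [eLpNorm_le_iff hp0 hp]
    refine le_trans (le_of_eq ?_) h1
    rw [withDensity_apply _ measurableSet_Ioi, ← lintegral_indicator (μ := halfLine) measurableSet_Ioi]
    refine lintegral_congr fun t => ?_
    by_cases ht : t ∈ Set.Ioi (m' : ℝ)
    · rw [Set.indicator_of_mem ht, Set.indicator_of_mem ht]
    · rw [Set.indicator_of_notMem ht, Set.indicator_of_notMem ht]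
      simp [hq]
  · rw [Measure.restrict_apply measurableSet_Ioi, Set.inter_comm] at h2
    exact h2

variable [Fact (1 ≤ p)] {H : Type*} [NormedAddCommGroup H] [InnerProductSpace ℝ H]

/-- On the restrictions of a sequence with bounded square function to a set of finite measure, an
operator into a Hilbert space is small arbitrarily late, because the squares of the norms of the
images are summable. -/
theorem exists_norm_res_le (hp : p ≠ ∞) (T : Space p →L[ℝ] H) (f : ℕ → Fun p) {A : ℝ} (hA : 0 < A)
    (hf : ∀ (s : Finset ℕ) t, ∑ i ∈ s, (f i).1 t ^ 2 ≤ A ^ 2) {E : Set ℝ} (hE : MeasurableSet E)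
    (hE' : halfLine E ≠ ∞) {δ : ℝ} (hδ : 0 < δ) (m : ℕ) :
    ∃ n, m < n ∧ ‖T (cls p (res hE (f n)))‖ ≤ δ := by
  by_contra! hcon
  set K := 64 * (‖T‖ * incl p E) ^ 2 * A ^ 2
  have h1 : ∀ N : ℕ, N * δ ^ 2 ≤ K := by
    intro N
    have h2 := sum_norm_sq_le_of_support hp T hE hE'
      (fun i : Fin N => res hE (f (m + 1 + i)))
      (fun i t ht => by rw [res_apply, Set.indicator_of_notMem ht]) hA fun t => by
        refine le_trans ?_ (hf (Finset.image (fun i : Fin N => m + 1 + (i : ℕ)) Finset.univ) t)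
        rw [Finset.sum_image fun i _ j _ h => Fin.ext (by simpa using h)]
        exact Finset.sum_le_sum fun i _ => sq_le_sq.2 (abs_res_le hE _ t)
    refine le_trans ?_ h2
    calc N * δ ^ 2 = ∑ i : Fin N, δ ^ 2 := by simp
      _ ≤ _ := Finset.sum_le_sum fun i _ => by
        have := hcon (m + 1 + i) (by omega)
        gcongr
  obtain ⟨N, hN⟩ := exists_nat_gt (K / δ ^ 2)
  rw [div_lt_iff₀ (by positivity)] at hN
  exact absurd (h1 N) (not_le.2 hN)

/-- An operator into a Hilbert space that is bounded below on a sequence with bounded square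
function is, on average, still bounded below on suitable disjoint pieces of a subsequence. The
part of each term to the left of its piece is negligible by the choice of the subsequence. The part
to the right is small in norm except on a set `E k`; all these sets lie in one set of finite
measure, where the little Grothendieck inequality applies. -/
theorem exists_disjoint_pieces (hp : p ≠ ∞) (T : Space p →L[ℝ] H) (f : ℕ → Fun p)
    (hfm : ∀ n, Measurable (f n).1) {A : ℝ} (hA : 0 < A)
    (hf : ∀ (s : Finset ℕ) t, ∑ i ∈ s, (f i).1 t ^ 2 ≤ A ^ 2)
    (hT : ∀ n, 1 ≤ ‖T (cls p (f n))‖) :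
    ∃ (n : ℕ → ℕ) (D : ℕ → Set ℝ) (hD : ∀ k, MeasurableSet (D k)) (K : ℝ),
      StrictMono n ∧ Pairwise (fun j k => Disjoint (D j) (D k)) ∧
      ∀ s : Finset ℕ, (s.card : ℝ) ≤ 8 * ∑ k ∈ s, ‖T (cls p (res (hD k) (f (n k))))‖ ^ 2 + K := by
  have hp0 : p ≠ 0 := (zero_lt_one.trans_le (Fact.out : 1 ≤ p)).ne'
  set δ : ℝ := 1 / (8 * (‖T‖ + 1)) with hδdef
  have hδ : 0 < δ := by positivity
  have hTδ : ‖T‖ * δ ≤ 1 / 8 := by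
    rw [hδdef, mul_one_div, div_le_div_iff₀ (by positivity) (by positivity)]
    linarith [norm_nonneg T]
  obtain ⟨η, hη, hηsum⟩ := ENNReal.exists_pos_sum_of_countable' (ε := 1) one_ne_zero ℕ
  choose M hMle hMnorm hMset using fun (n k m : ℕ) =>
    exists_tail_small hp0 hp (f n) (hfm n) hδ (hη k) m
  choose N hNlt hNnorm using fun (m' n : ℕ) =>
    exists_norm_res_le hp T f hA hf (E := Set.Iic (m' : ℝ)) measurableSet_Iic
      (by
        rw [Measure.restrict_apply measurableSet_Iic, Set.Iic_inter_Ioi]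
        exact measure_Ioc_lt_top.ne) (δ := 1 / 8) (by norm_num) n
  -- The pairs `(n k, m k)` of an index and a left end point.
  let u : ℕ → ℕ × ℕ := fun k => Nat.rec (N 0 0, 0)
    (fun k x => (N (M x.1 k x.2) x.1, M x.1 k x.2)) k
  let n : ℕ → ℕ := fun k => (u k).1
  let m : ℕ → ℕ := fun k => (u k).2
  have hm : ∀ k, m (k + 1) = M (n k) k (m k) := fun k => rfl
  have hn : ∀ k, n (k + 1) = N (m (k + 1)) (n k) := fun k => rfl
  have hnmono : StrictMono n := strictMono_nat_of_lt_succ fun k => by rw [hn]; exact hNlt _ _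
  have hmmono : Monotone m := monotone_nat_of_le_succ fun k => by rw [hm]; exact hMle _ _ _
  have hleft : ∀ k, ‖T (cls p (res (measurableSet_Iic (a := (m k : ℝ))) (f (n k))))‖ ≤ 1 / 8 := by
    intro k
    cases k with
    | zero => exact hNnorm 0 0
    | succ k => exact hNnorm (m (k + 1)) (n k)
  let D : ℕ → Set ℝ := fun k => Set.Ioc (m k : ℝ) (m (k + 1))
  have hD : ∀ k, MeasurableSet (D k) := fun k => measurableSet_Ioc
  let E : ℕ → Set ℝ := fun k => {t | δ < |(f (n k)).1 t|} ∩ Set.Ioi (m (k + 1) : ℝ)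
  have hE : ∀ k, MeasurableSet (E k) := fun k =>
    (measurableSet_lt measurable_const (hfm _).abs).inter measurableSet_Ioi
  let W : ℕ → Set ℝ := fun k => Set.Ioi (m (k + 1) : ℝ) \ E k
  have hW : ∀ k, MeasurableSet (W k) := fun k => measurableSet_Ioi.diff (hE k)
  have hU : MeasurableSet (⋃ k, E k) := MeasurableSet.iUnion hE
  have hU' : halfLine (⋃ k, E k) ≠ ∞ := by
    refine ne_top_of_le_ne_top ENNReal.one_ne_top ((measure_iUnion_le _).trans ?_)
    exact (ENNReal.tsum_le_tsum fun k => hMset _ _ _).trans hηsum.le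
  have hright : ∀ k, ‖T (cls p (res (hW k) (f (n k))))‖ ≤ 1 / 8 := by
    intro k
    refine (T.le_opNorm _).trans (le_trans ?_ hTδ)
    gcongr
    refine norm_cls_le hδ.le ?_ fun t => ?_
    · refine le_trans (eLpNorm_mono fun t => ?_) (hMnorm (n k) k (m k))
      rw [res_apply, ← hm]
      exact Set.indicator_le_indicator_of_subset Set.sdiff_subset (fun _ => norm_nonneg _) t
        |> fun h => by simpa only [norm_indicator_eq_indicator_norm] using h
    · rw [res_apply]
      by_cases ht : t ∈ W k
      · rw [Set.indicator_of_mem ht]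
        by_contra! hcon
        exact ht.2 ⟨hcon, ht.1⟩
      · rw [Set.indicator_of_notMem ht, abs_zero]; exact hδ.le
  have hdecomp : ∀ k, f (n k) = res (measurableSet_Iic (a := (m k : ℝ))) (f (n k))
      + res (hD k) (f (n k)) + res (hE k) (f (n k)) + res (hW k) (f (n k)) := by
    intro k
    refine Subtype.ext (funext fun t => ?_)
    change (f (n k)).1 t = (Set.Iic (m k : ℝ)).indicator (f (n k)).1 t
      + (D k).indicator (f (n k)).1 t + (E k).indicator (f (n k)).1 t
      + (W k).indicator (f (n k)).1 t
    have hmm : (m k : ℝ) ≤ m (k + 1) := Nat.cast_le.2 (hmmono k.le_succ)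
    have hEt : t ∈ E k → (m (k + 1) : ℝ) < t := fun h => h.2
    have hWt : t ∈ W k ↔ (m (k + 1) : ℝ) < t ∧ t ∉ E k := Iff.rfl
    have hDt : t ∈ D k ↔ (m k : ℝ) < t ∧ t ≤ m (k + 1) := Iff.rfl
    have hIt : t ∈ Set.Iic (m k : ℝ) ↔ t ≤ m k := Iff.rfl
    simp only [Set.indicator_apply, hIt, hDt, hWt]
    split_ifs <;> first | (simp; done) | (exfalso; grind)
  refine ⟨n, D, hD, 8 * (64 * (‖T‖ * incl p (⋃ k, E k)) ^ 2 * A ^ 2), hnmono, ?_, fun s => ?_⟩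
  · refine (pairwise_disjoint_on D).2 fun j k hjk => Set.disjoint_left.2 fun t h1 h2 => ?_
    have : (m (j + 1) : ℝ) ≤ m k := Nat.cast_le.2 (hmmono hjk)
    exact absurd (h1.2.trans this) (not_le.2 h2.1)
  · have hG := sum_norm_sq_le_of_support hp T hU hU'
      (fun k : s => res (hE k) (f (n k))) (fun k t ht => by
        rw [res_apply, Set.indicator_of_notMem fun h => ht (Set.mem_iUnion.2 ⟨_, h⟩)])
      hA fun t => by
        refine le_trans ?_ (hf (s.image n) t)
        rw [Finset.sum_image fun i _ j _ h => hnmono.injective h,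
          ← Finset.sum_coe_sort s fun k => (f (n k)).1 t ^ 2]
        exact Finset.sum_le_sum fun i _ => sq_le_sq.2 (abs_res_le (hE i) _ t)
    rw [Finset.sum_coe_sort s fun k => ‖T (cls p (res (hE k) (f (n k))))‖ ^ 2] at hG
    have h1 : ∀ k, (1 : ℝ) ≤ 8 * ‖T (cls p (res (hD k) (f (n k))))‖ ^ 2
        + 8 * ‖T (cls p (res (hE k) (f (n k))))‖ ^ 2 := by
      intro k
      have h2 := hT (n k)
      rw [hdecomp k, map_add, map_add, map_add, map_add, map_add, map_add] at h2
      have h3 := h2.trans (norm_add₄_le)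
      have h4 := hleft k
      have h5 := hright k
      generalize ‖T (cls p (res (hD k) (f (n k))))‖ = a at *
      generalize ‖T (cls p (res (hE k) (f (n k))))‖ = b at *
      have h6 : 3 / 4 ≤ a + b := by linarith
      nlinarith [sq_nonneg (a - b)]
    calc (s.card : ℝ) = ∑ k ∈ s, 1 := by simp
      _ ≤ ∑ k ∈ s, (8 * ‖T (cls p (res (hD k) (f (n k))))‖ ^ 2
        + 8 * ‖T (cls p (res (hE k) (f (n k))))‖ ^ 2) := Finset.sum_le_sum fun k _ => h1 k
      _ ≤ _ := by
        rw [Finset.sum_add_distrib, ← Finset.mul_sum, ← Finset.mul_sum]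
        gcongr

end LpCapLinfty

/-! ### Disjoint pieces and the exponent -/

namespace LpCapLinfty

open Rademacher

theorem not_forall_natCast_le {α : ℝ} (hα : α < 1) (C : ℝ) :
    ¬ ∀ N : ℕ, 1 ≤ N → (N : ℝ) ≤ C * (N : ℝ) ^ α := by
  intro h
  have h1 : Filter.Tendsto (fun N : ℕ => (N : ℝ) ^ (1 - α)) Filter.atTop Filter.atTop :=
    (tendsto_rpow_atTop (by linarith)).comp tendsto_natCast_atTop_atTop
  obtain ⟨N, h2, h3⟩ := ((h1.eventually_gt_atTop C).and (Filter.eventually_ge_atTop 1)).exists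
  have hN : (0 : ℝ) < N := by exact_mod_cast h3
  have h4 := h N h3
  have h5 : (N : ℝ) ^ (1 - α) * (N : ℝ) ^ α = N := by
    rw [← Real.rpow_add hN, sub_add_cancel, Real.rpow_one]
  have h6 : 0 < (N : ℝ) ^ α := by positivity
  nlinarith

variable {p : ℝ≥0∞}

theorem Fun.sum_smul_apply {ι : Type*} (s : Finset ι) (c : ι → ℝ) (f : ι → Fun p) (t : ℝ) :
    (∑ i ∈ s, c i • f i).1 t = ∑ i ∈ s, c i * (f i).1 t := by
  simp [Finset.sum_apply]

theorem aemeasurable_enorm_rpow (f : Fun p) (q : ℝ) :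
    AEMeasurable (fun t => ‖f.1 t‖ₑ ^ q) halfLine :=
  f.2.1.1.aemeasurable.enorm.pow_const q

/-- The upper `p`-estimate for disjoint functions, transported to a Hilbert space: there the mean
square of the signed sums is the sum of the squares. -/
theorem sum_norm_sq_le_of_disjoint [Fact (1 ≤ p)] {H : Type*} [NormedAddCommGroup H]
    [InnerProductSpace ℝ H] (hp : p ≠ ∞) (T : Space p →L[ℝ] H) {ι : Type*} [Fintype ι]
    (v : ι → Fun p) (hv : ∀ t i j, (v i).1 t ≠ 0 → (v j).1 t ≠ 0 → i = j) {c : ℝ} (hc : 0 ≤ c)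
    (hvc : ∀ i t, |(v i).1 t| ≤ c)
    (hS : ∑ i, ∫⁻ t, ‖(v i).1 t‖ₑ ^ p.toReal ∂halfLine ≤ ENNReal.ofReal c ^ p.toReal) :
    ∑ i, ‖T (cls p (v i))‖ ^ 2 ≤ (‖T‖ * c) ^ 2 := by
  classical
  have hp0 : p ≠ 0 := (zero_lt_one.trans_le (Fact.out : 1 ≤ p)).ne'
  have hq : 0 < p.toReal := ENNReal.toReal_pos hp0 hp
  rw [← avg_norm_sq]
  refine avg_le_const fun ω => ?_
  have h1 : ∑ i, rad i ω • T (cls p (v i)) = T (cls p (∑ i, rad i ω • v i)) := by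
    simp only [map_sum, map_smul]
  -- At each point at most one term of the sum is nonzero.
  have h2 : ∀ t, (∀ i, (v i).1 t = 0) ∧ (∑ i, rad i ω • v i).1 t = 0 ∨
      ∃ i, |(∑ i, rad i ω • v i).1 t| = |(v i).1 t| := by
    intro t
    rw [Fun.sum_smul_apply]
    by_cases h : ∀ i, (v i).1 t = 0
    · exact Or.inl ⟨h, by simp [h]⟩
    · push Not at h
      obtain ⟨i, hi⟩ := h
      refine Or.inr ⟨i, ?_⟩
      rw [Finset.sum_eq_single i, abs_mul, abs_rad, one_mul]
      · intro j _ hj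
        by_contra hcon
        exact hj (hv t j i (right_ne_zero_of_mul hcon) hi)
      · simp
  have h3 : ‖cls p (∑ i, rad i ω • v i)‖ ≤ c := by
    refine norm_cls_le hc ?_ fun t => ?_
    · rw [eLpNorm_le_iff hp0 hp]
      refine le_trans ?_ hS
      rw [← lintegral_finsetSum' _ fun i _ => aemeasurable_enorm_rpow _ _]
      refine lintegral_mono fun t => ?_
      rcases h2 t with ⟨_, h⟩ | ⟨i, h⟩
      · simp [h, hq]
      · rw [Real.enorm_eq_ofReal_abs, h, ← Real.enorm_eq_ofReal_abs]
        exact Finset.single_le_sum (f := fun i => ‖(v i).1 t‖ₑ ^ p.toReal)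
          (fun _ _ => zero_le) (Finset.mem_univ i)
    · rcases h2 t with ⟨_, h⟩ | ⟨i, h⟩
      · simpa [h] using hc
      · rw [h]; exact hvc i t
  rw [h1]
  have := (T.le_opNorm (cls p (∑ i, rad i ω • v i))).trans
    (mul_le_mul_of_nonneg_left h3 (norm_nonneg T))
  gcongr

/-- Disjoint pieces of functions whose signed sums are bounded in `L_p` satisfy a `p`-estimate. -/
theorem sum_lintegral_res_le [Fact (1 ≤ p)] (hp : p ≠ ∞) {ι : Type*} [Fintype ι] (g : ι → Fun p)
    {D : ι → Set ℝ} (hD : ∀ i, MeasurableSet (D i))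
    (hDD : Pairwise fun i j => Disjoint (D i) (D j)) {c : ℝ≥0∞}
    (hg : ∀ ω : ι → Bool, eLpNorm (∑ i, rad i ω • g i).1 p halfLine ≤ c) :
    ∑ i, ∫⁻ t, ‖(res (hD i) (g i)).1 t‖ₑ ^ p.toReal ∂halfLine ≤ c ^ p.toReal := by
  classical
  have hp0 : p ≠ 0 := (zero_lt_one.trans_le (Fact.out : 1 ≤ p)).ne'
  have hq : 0 < p.toReal := ENNReal.toReal_pos hp0 hp
  have hq1 : 1 ≤ p.toReal := by
    rw [← ENNReal.toReal_one]; exact ENNReal.toReal_mono hp Fact.out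
  set w : ℝ≥0∞ := ENNReal.ofReal (((2 : ℝ) ^ Fintype.card ι)⁻¹) with hw
  have hw1 : ∑ _ω : ι → Bool, w = 1 := by
    rw [hw, ← ENNReal.ofReal_sum_of_nonneg fun _ _ => by positivity]
    simp
  have hpt : ∀ t, ∑ i, ‖(res (hD i) (g i)).1 t‖ₑ ^ p.toReal
      ≤ ∑ ω, w * ‖(∑ i, rad i ω • g i).1 t‖ₑ ^ p.toReal := by
    intro t
    have hen : ∀ x : ℝ, ‖x‖ₑ ^ p.toReal = ENNReal.ofReal (|x| ^ p.toReal) := fun x => by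
      rw [Real.enorm_eq_ofReal_abs, ENNReal.ofReal_rpow_of_nonneg (abs_nonneg x) hq.le]
    by_cases h : ∃ i, t ∈ D i
    · obtain ⟨i, hi⟩ := h
      rw [Finset.sum_eq_single i]
      · rw [res_apply, Set.indicator_of_mem hi, hen]
        refine (ENNReal.ofReal_le_ofReal (rpow_abs_le_avg (fun j => (g j).1 t) i hq1)).trans ?_
        simp only [avg, smul_eq_mul, Finset.mul_sum (s := (Finset.univ : Finset (ι → Bool)))]
        rw [ENNReal.ofReal_sum_of_nonneg fun _ _ => by positivity]
        refine Finset.sum_le_sum fun ω _ => ?_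
        rw [ENNReal.ofReal_mul (by positivity), ← hen, Fun.sum_smul_apply]
      · intro j _ hj
        rw [res_apply, Set.indicator_of_notMem (Set.disjoint_left.1 (hDD hj.symm) hi)]
        simp [hq]
      · simp
    · push Not at h
      simp [res_apply, h, hq]
  rw [← lintegral_finsetSum' _ fun i _ => aemeasurable_enorm_rpow _ _]
  refine (lintegral_mono hpt).trans ?_
  rw [lintegral_finsetSum' _ fun i _ => (aemeasurable_enorm_rpow _ _).const_mul _]
  calc _ ≤ ∑ ω : ι → Bool, w * c ^ p.toReal := Finset.sum_le_sum fun ω _ => by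
        rw [lintegral_const_mul'' _ (aemeasurable_enorm_rpow _ _)]
        gcongr
        exact (eLpNorm_le_iff hp0 hp).1 (hg ω)
    _ = c ^ p.toReal := by rw [← Finset.sum_mul, hw1, one_mul]

/-- If the identity of `l_2` factors through `L_p ∩ L_∞`, then `p = 2`. -/
theorem eq_two_of_factorization [Fact (1 ≤ p)] (hp : p ≠ ∞)
    (J : lp (fun _ : ℕ => ℝ) 2 →L[ℝ] Space p) (T : Space p →L[ℝ] lp (fun _ : ℕ => ℝ) 2)
    (hTJ : ∀ a, T (J a) = a) : p = 2 := by
  classical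
  have hp0 : p ≠ 0 := (zero_lt_one.trans_le (Fact.out : 1 ≤ p)).ne'
  have hq : 0 < p.toReal := ENNReal.toReal_pos hp0 hp
  set q := p.toReal with hqdef
  let e : ℕ → lp (fun _ : ℕ => ℝ) 2 := fun n => lp.single 2 n (1 : ℝ)
  have he1 : ∀ n, ‖e n‖ = 1 := fun n => by simp [e, lp.norm_single]
  have he : ∀ (s : Finset ℕ) (a : ℕ → ℝ), ‖∑ i ∈ s, a i • e i‖ = √(∑ i ∈ s, a i ^ 2) := by
    intro s a
    have h := lp.norm_sum_single (E := fun _ : ℕ => ℝ) (p := 2) (by norm_num) a s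
    have h2 : ∑ i ∈ s, a i • e i = ∑ i ∈ s, lp.single 2 i (a i) :=
      Finset.sum_congr rfl fun i _ => by
        rw [← lp.single_smul, smul_eq_mul, mul_one]
    rw [h2, ← Real.sqrt_sq (norm_nonneg _)]
    congr 1
    simpa using h
  set A := ‖J‖ + 1 with hA
  have hA0 : 0 < A := by positivity
  have hJ : ∀ (s : Finset ℕ) (a : ℕ → ℝ), ‖∑ i ∈ s, a i • J (e i)‖ ≤ A * √(∑ i ∈ s, a i ^ 2) := by
    intro s a
    have h : ∑ i ∈ s, a i • J (e i) = J (∑ i ∈ s, a i • e i) := by simp only [map_sum, map_smul]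
    rw [h, ← he s a]
    refine (J.le_opNorm _).trans ?_
    gcongr
    linarith
  obtain ⟨f, hfm, hfx, hfN⟩ := exists_square_function_le (fun n => J (e n)) hA0.le
    (by
      rintro N a y rfl
      have h := hJ (Finset.range N) fun i => if h : i < N then a ⟨i, h⟩ else 0
      simpa [Finset.sum_range] using h)
  have hf : ∀ (s : Finset ℕ) t, ∑ i ∈ s, (f i).1 t ^ 2 ≤ A ^ 2 := by
    intro s t
    obtain ⟨N, hN⟩ := s.exists_nat_subset_range
    refine le_trans (Finset.sum_le_sum_of_subset_of_nonneg hN fun _ _ _ => sq_nonneg _) ?_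
    rw [Finset.sum_range]
    exact hfN N t
  have hfA : ∀ n t, |(f n).1 t| ≤ A := fun n t =>
    abs_le_of_sq_le_sq (by simpa using hf {n} t) hA0.le
  obtain ⟨n, D, hD, K, hn, hDD, hK⟩ := exists_disjoint_pieces hp T f hfm hA0 hf
    (fun n => by rw [hfx, hTJ, he1])
  let v : ℕ → Fun p := fun k => res (hD k) (f (n k))
  let I : ℕ → ℝ≥0∞ := fun k => ∫⁻ t, ‖(v k).1 t‖ₑ ^ q ∂halfLine
  -- A `p`-estimate for the pieces bounds the number of pieces.
  have hcard : ∀ (s : Finset ℕ) (c : ℝ), A ≤ c → ∑ k ∈ s, I k ≤ ENNReal.ofReal c ^ q →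
      (s.card : ℝ) ≤ 8 * (‖T‖ * c) ^ 2 + K := by
    intro s c hAc hc
    refine (hK s).trans ?_
    gcongr
    rw [← Finset.sum_coe_sort s fun k => ‖T (cls p (res (hD k) (f (n k))))‖ ^ 2]
    refine sum_norm_sq_le_of_disjoint hp T (fun k : s => v k) ?_ (hA0.le.trans hAc)
      (fun k t => (abs_res_le _ _ _).trans ((hfA _ _).trans hAc)) ?_
    · intro t i j hi hj
      by_contra hij
      have hne : (i : ℕ) ≠ j := fun h => hij (Subtype.ext h)
      exact Set.disjoint_left.1 (hDD hne) (Set.mem_of_indicator_ne_zero hi)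
        (Set.mem_of_indicator_ne_zero hj)
    · rwa [Finset.sum_coe_sort s I]
  -- The pieces inherit a `p`-estimate from `J`.
  have hsum : ∀ s : Finset ℕ, ∑ k ∈ s, I k ≤ ENNReal.ofReal (A * √s.card) ^ q := by
    intro s
    rw [← Finset.sum_coe_sort s I]
    refine sum_lintegral_res_le hp (fun k : s => f (n k)) (D := fun k => D k) (fun k => hD k)
      (fun i j hij => hDD fun h => hij (Subtype.ext h)) fun ω => ?_
    refine (eLpNorm_le_norm_cls _).trans (ENNReal.ofReal_le_ofReal ?_)
    have h := hJ (Finset.image (fun k : s => n k) Finset.univ)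
      (fun i => if h : ∃ k : s, n k = i then rad h.choose ω else 0)
    rw [Finset.sum_image fun i _ j _ h => Subtype.ext (hn.injective h),
      Finset.sum_image fun i _ j _ h => Subtype.ext (hn.injective h)] at h
    have h2 : ∀ k : s, (if h : ∃ k' : s, n k' = n k then rad h.choose ω else 0) = rad k ω := by
      intro k
      have h3 : ∃ k' : s, n k' = n k := ⟨k, rfl⟩
      rw [dif_pos h3, Subtype.ext (hn.injective h3.choose_spec)]
    simp only [h2, rad_sq] at h
    simpa [hfx] using h
  have hp2 : p = 2 ↔ q = 2 := by
    rw [hqdef]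
    constructor
    · rintro rfl; simp
    · intro h
      rw [← ENNReal.ofReal_toReal hp, h]; simp
  rw [hp2]
  rcases lt_trichotomy q 2 with hlt | heq | hgt
  · exfalso
    -- For `p < 2` the pieces tend to zero in `L_p`, so `N` of them have bounded signed sums.
    have hfin : ∀ η : ℝ, 0 < η → {k | ENNReal.ofReal η < I k}.Finite := by
      intro η hη
      by_contra hinf
      refine not_forall_natCast_le (α := q / 2) (by linarith) (A ^ q / η) fun N _ => ?_
      obtain ⟨s, hs, hsN⟩ := Set.Infinite.exists_subset_card_eq hinf N
      have h1 : (N : ℝ≥0∞) * ENNReal.ofReal η ≤ ENNReal.ofReal (A * √N) ^ q := by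
        refine le_trans ?_ (hsN ▸ hsum s)
        rw [← hsN, ← nsmul_eq_mul]
        exact Finset.card_nsmul_le_sum _ _ _ fun k hk => (hs hk).le
      rw [ENNReal.ofReal_rpow_of_nonneg (by positivity) hq.le, ← ENNReal.ofReal_natCast,
        ← ENNReal.ofReal_mul (by positivity), ENNReal.ofReal_le_ofReal_iff (by positivity),
        Real.mul_rpow hA0.le (by positivity), Real.sqrt_eq_rpow, ← Real.rpow_mul (by positivity),
        one_div_mul_eq_div] at h1
      rw [div_mul_eq_mul_div, le_div_iff₀ hη]
      exact h1
    refine not_forall_natCast_le (α := 0) (by norm_num) (8 * (‖T‖ * max A 1) ^ 2 + K) fun N hN => ?_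
    have hN0 : (0 : ℝ) < N := by exact_mod_cast hN
    obtain ⟨s, hs, hsN⟩ := (hfin (1 / N) (by positivity)).infinite_compl.exists_subset_card_eq N
    rw [Real.rpow_zero, mul_one, ← hsN]
    refine hcard s _ (le_max_left _ _) ?_
    calc ∑ k ∈ s, I k ≤ ∑ k ∈ s, ENNReal.ofReal (1 / N) :=
          Finset.sum_le_sum fun k hk => not_lt.1 (hs hk)
      _ = 1 := by
        rw [Finset.sum_const, hsN, nsmul_eq_mul, ← ENNReal.ofReal_natCast,
          ← ENNReal.ofReal_mul hN0.le, mul_one_div_cancel hN0.ne', ENNReal.ofReal_one]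
      _ ≤ _ := by
        refine ENNReal.one_le_rpow ?_ hq
        rw [ENNReal.one_le_ofReal]
        exact le_max_right _ _
  · exact heq
  · exfalso
    -- For `p > 2` the pieces satisfy a `p`-estimate that is too good for `l_2`.
    refine not_forall_natCast_le (α := 2 / q) ((div_lt_one hq).2 hgt)
      (8 * (‖T‖ * A) ^ 2 + |K|) fun N hN => ?_
    have hN1 : (1 : ℝ) ≤ N := by exact_mod_cast hN
    have hI : ∀ k, I k ≤ ENNReal.ofReal A ^ q := by
      intro k
      have h := hsum {k}
      simpa using h
    have h := hcard (Finset.range N) (A * (N : ℝ) ^ (1 / q))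
      (le_mul_of_one_le_right hA0.le (Real.one_le_rpow hN1 (by positivity))) (by
        refine (Finset.sum_le_card_nsmul _ _ _ fun k _ => hI k).trans_eq ?_
        rw [Finset.card_range, nsmul_eq_mul, ENNReal.ofReal_mul hA0.le,
          ENNReal.mul_rpow_of_nonneg _ _ hq.le,
          ENNReal.ofReal_rpow_of_nonneg (x := (N : ℝ) ^ (1 / q)) (by positivity) hq.le,
          ← Real.rpow_mul (by positivity), one_div_mul_cancel hq.ne', Real.rpow_one,
          ENNReal.ofReal_natCast, mul_comm])
    rw [Finset.card_range] at h
    have h2 : ((N : ℝ) ^ (1 / q)) ^ 2 = (N : ℝ) ^ (2 / q) := by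
      rw [← Real.rpow_natCast, ← Real.rpow_mul (by positivity)]
      congr 1
      push_cast
      ring
    have h3 : (1 : ℝ) ≤ (N : ℝ) ^ (2 / q) := Real.one_le_rpow hN1 (by positivity)
    calc (N : ℝ) ≤ 8 * (‖T‖ * (A * (N : ℝ) ^ (1 / q))) ^ 2 + K := h
      _ = 8 * (‖T‖ * A) ^ 2 * (N : ℝ) ^ (2 / q) + K := by rw [← h2]; ring
      _ ≤ 8 * (‖T‖ * A) ^ 2 * (N : ℝ) ^ (2 / q) + |K| * (N : ℝ) ^ (2 / q) := by
        gcongr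
        exact (le_abs_self K).trans (le_mul_of_one_le_right (abs_nonneg K) h3)
      _ = _ := by ring

end LpCapLinfty

/-! ### Step functions and the case `p = 2` -/

namespace LpCapLinfty

theorem measurePreserving_floor :
    MeasurePreserving (fun t : ℝ => ⌊t⌋₊) halfLine Measure.count := by
  refine ⟨Nat.measurable_floor, Measure.ext_of_singleton fun n => ?_⟩
  rw [Measure.map_apply Nat.measurable_floor (measurableSet_singleton n), Measure.count_singleton,
    Measure.restrict_apply (Nat.measurable_floor (measurableSet_singleton n))]
  have h : ((fun t : ℝ => ⌊t⌋₊) ⁻¹' {n} ∩ Set.Ioi 0 : Set ℝ) =ᵐ[volume]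
      (Set.Ico (n : ℝ) (n + 1) : Set ℝ) := by
    have h0 : ∀ᵐ t : ℝ, t ≠ 0 := by simp [ae_iff]
    refine Filter.eventuallyEq_set.2 ?_
    filter_upwards [h0] with t ht
    change (⌊t⌋₊ = n ∧ 0 < t) ↔ (n : ℝ) ≤ t ∧ t < n + 1
    constructor
    · rintro ⟨h1, h2⟩
      exact (Nat.floor_eq_iff h2.le).1 h1
    · intro h1
      have h2 : 0 < t := lt_of_le_of_ne ((Nat.cast_nonneg n).trans h1.1) ht.symm
      exact ⟨(Nat.floor_eq_iff h2.le).2 h1, h2⟩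
  rw [measure_congr h]
  simp

theorem eLpNorm_two_count (a : lp (fun _ : ℕ => ℝ) 2) :
    eLpNorm (fun n => a n) 2 Measure.count = ENNReal.ofReal ‖a‖ := by
  have h1 := lp.norm_rpow_eq_tsum (by norm_num) a
  have h2 := (lp.memℓp a).summable (by norm_num)
  rw [eLpNorm_eq_lintegral_rpow_enorm_toReal (by norm_num) (by norm_num), lintegral_count]
  have h3 : ∀ n, ‖a n‖ₑ ^ (2 : ℝ≥0∞).toReal = ENNReal.ofReal (‖a n‖ ^ (2 : ℝ≥0∞).toReal) := by
    intro n
    rw [← ofReal_norm, ENNReal.ofReal_rpow_of_nonneg (norm_nonneg _) (by norm_num)]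
  simp only [h3]
  rw [← ENNReal.ofReal_tsum_of_nonneg (fun _ => by positivity) h2, ← h1,
    ← ENNReal.ofReal_rpow_of_nonneg (norm_nonneg _) (by norm_num), ← ENNReal.rpow_mul]
  norm_num

theorem eLpNorm_step (a : lp (fun _ : ℕ => ℝ) 2) :
    eLpNorm (fun t : ℝ => a ⌊t⌋₊) 2 halfLine = ENNReal.ofReal ‖a‖ := by
  rw [← eLpNorm_two_count]
  exact eLpNorm_comp_measurePreserving (measurable_of_countable _).aestronglyMeasurable
    measurePreserving_floor

theorem measurable_step (a : lp (fun _ : ℕ => ℝ) 2) : Measurable fun t : ℝ => a ⌊t⌋₊ :=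
  (measurable_of_countable _).comp Nat.measurable_floor

/-- The step function with the terms of a square summable sequence as its values on the intervals
`[n, n + 1)`. -/
def step : lp (fun _ : ℕ => ℝ) 2 →ₗ[ℝ] Fun 2 where
  toFun a := ⟨fun t => a ⌊t⌋₊,
    ⟨(measurable_step a).aestronglyMeasurable, by rw [eLpNorm_step]; finiteness⟩,
    memLp_top_of_bound (measurable_step a).aestronglyMeasurable ‖a‖
      (Filter.Eventually.of_forall fun t => lp.norm_apply_le_norm (by norm_num) a _)⟩
  map_add' _ _ := rfl
  map_smul' _ _ := rfl

theorem norm_cls_step_le (a : lp (fun _ : ℕ => ℝ) 2) : ‖cls 2 (step a)‖ ≤ ‖a‖ :=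
  norm_cls_le (norm_nonneg a) (eLpNorm_step a).le
    fun _ => lp.norm_apply_le_norm (by norm_num) a _

/-- The isometric embedding of `l_2` into `L_2` by step functions. -/
def stepL2 : lp (fun _ : ℕ => ℝ) 2 →ₗᵢ[ℝ] Lp ℝ 2 halfLine where
  toLinearMap := toLp 2 ∘ₗ cls 2 ∘ₗ step
  norm_map' a := by
    change (eLpNorm (AEEqFun.mk (step a).1 (step a).2.1.1) 2 halfLine).toReal = ‖a‖
    rw [eLpNorm_congr_ae (AEEqFun.coeFn_mk _ _)]
    change (eLpNorm (fun t : ℝ => a ⌊t⌋₊) 2 halfLine).toReal = ‖a‖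
    rw [eLpNorm_step, ENNReal.toReal_ofReal (norm_nonneg a)]

/-- The inclusion of `L_2 ∩ L_∞` into `L_2` as a bounded operator. -/
def toL2 : Space 2 →L[ℝ] Lp ℝ 2 halfLine :=
  (toLp 2).mkContinuous 1 fun f => by
    rw [one_mul, norm_eq_max]; exact le_max_left _ _

/-- The identity of `l_2` factors through `L_2 ∩ L_∞`: the left inverse of the embedding by step
functions is the adjoint of the embedding into `L_2`. -/
theorem exists_factorization_two :
    ∃ (J : lp (fun _ : ℕ => ℝ) 2 →L[ℝ] Space 2) (T : Space 2 →L[ℝ] lp (fun _ : ℕ => ℝ) 2),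
      ∀ a, T (J a) = a := by
  refine ⟨(cls 2 ∘ₗ step).mkContinuous 1 fun a => ?_,
    (ContinuousLinearMap.adjoint stepL2.toContinuousLinearMap).comp toL2, fun a => ?_⟩
  · rw [one_mul]; exact norm_cls_step_le a
  · exact DFunLike.congr_fun stepL2.adjoint_comp_self a

end LpCapLinfty

end

/-- A complemented copy of `Y` in `X` is the same as a factorization of the identity of `Y`
through `X`. -/
theorem containsComplementedCopy_iff {X Y : Type*} [NormedAddCommGroup X] [NormedSpace ℝ X]
    [NormedAddCommGroup Y] [NormedSpace ℝ Y] :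
    ContainsComplementedCopy X Y ↔
      ∃ (J : Y →L[ℝ] X) (T : X →L[ℝ] Y), ∀ y, T (J y) = y := by
  constructor
  · rintro ⟨S, ⟨P, hP⟩, ⟨e⟩⟩
    refine ⟨S.subtypeL.comp e.symm.toContinuousLinearMap, e.toContinuousLinearMap.comp P,
      fun y => ?_⟩
    have := hP (e.symm y)
    simp [this]
  · rintro ⟨J, T, h⟩
    let J' : Y →L[ℝ] J.range := J.codRestrict J.range fun y => ⟨y, rfl⟩
    refine ⟨J.range, ⟨J'.comp T, ?_⟩, ⟨ContinuousLinearEquiv.equivOfInverse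
      (T.comp J.range.subtypeL) J' ?_ ?_⟩⟩
    · rintro ⟨_, y, rfl⟩
      exact Subtype.ext (congrArg J (h y))
    · rintro ⟨_, y, rfl⟩
      exact Subtype.ext (congrArg J (h y))
    · exact h

theorem theorem4 (p : ℝ≥0∞) [Fact (1 ≤ p)] (hp : p < ∞) :
    ContainsComplementedCopy (LpCapLinfty.Space p) (lp (fun _ : ℕ => ℝ) 2) ↔ p = 2 := by
  rw [containsComplementedCopy_iff]
  constructor
  · rintro ⟨J, T, h⟩
    exact LpCapLinfty.eq_two_of_factorization hp.ne J T h
  · rintro rfl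
    exact LpCapLinfty.exists_factorization_two
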